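/- Let $F$ be an oriented surface of negative Euler characteristic, possibly with boundary and punctures. A marked hyperbolic surface $(X,\varphi_X)$ over $F$ consists of a complete hyperbolic surface $X$ of finite area, with (possibly empty) totally geodesic boundary consisting of closed geodesics, and a homeomorphism $\varphi_X:F\to X$; these pairs represent the points of the Teichmüller space $\mathcal T(F)$. If $x,y$ are oriented closed geodesics in $X$, parametrized by arc length with lengths $\ell_x,\ell_y>0$ (not necessarily simple or primitive), an intersection point $p$ of $x$ and $y$ is a pair of parameters $(s,t)$ with $x(s)=y(t)$. Write $x_p,y_p$ for the loops based at the point $x(s)=y(t)$ that run once along $x$, respectively $y$, in the positive direction; $x*_py$ for the loop product "first $x_p$, then $y_p$"; $\langle\cdot\rangle$ for the free homotopy class of a loop; and $\theta_p\in[0,\pi]$ for the angle at $p$ between the positive directions of $x$ and $y$. Let $(X,\varphi_X)$ and $(Y,\varphi_Y)$ be marked hyperbolic surfaces over $F$ and let $\psi=\varphi_Y\circ\varphi_X^{-1}:X\to Y$. Let $x,y$ be oriented closed geodesics in $X$, and let $x',y'$ be closed geodesics in $Y$ in the free homotopy classes of $\psi\circ x$ and $\psi\circ y$. An intersection point $p$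 of $x,y$ is identified with an intersection point $p'$ of $x',y'$ if the pair of loops $(\psi\circ x_p,\psi\circ y_p)$ is freely homotopic to the pair $(x'_{p'},y'_{p'})$ through pairs of loops with a common base point; in that case put $\theta_p(Y)=\theta_{p'}$. **Theorem.** Let $x$ and $y$ be oriented closed geodesics in $X$ and let $p$ and $q$ be intersection points of $x$ and $y$ such that $$\langle x*_p y\rangle=\langle x*_q y\rangle .$$ Then for every marked hyperbolic surface $Y$ over $F$, $$\theta_p(Y)=\theta_q(Y),$$ that is, if $p',q'$ are intersection points of the geodesic representatives $x',y'$ in $Y$ that are identified with $p$ and $q$ respectively, then $\theta_{p'}=\theta_{q'}$. In particular, taking $Y=X$, $\theta_p=\theta_q$ in $X$. -/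

import Mathlib

open UpperHalfPlane MeasureTheory
open scoped MatrixGroups unitInterval

noncomputable section

/-! ### Free homotopy of loops -/

/-- Two loops, possibly with different base points, are freely homotopic: there is a homotopy
through closed loops. (The first variable of `H` is the homotopy parameter.) -/
def FreelyHomotopic {Z : Type*} [TopologicalSpace Z] {a b : Z} (α : Path a a) (β : Path b b) :
    Prop :=
  ∃ H : C(I × I, Z), (∀ t, H (0, t) = α t) ∧ (∀ t, H (1, t) = β t) ∧ ∀ s, H (s, 0) = H (s, 1)

/-- Two pairs of loops with common base points `a` and `b` are simultaneously freely homotopic: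
the two maps from the figure eight that they define are homotopic. -/
def SimultaneouslyFreelyHomotopic {Z : Type*} [TopologicalSpace Z] {a b : Z}
    (α₁ α₂ : Path a a) (β₁ β₂ : Path b b) : Prop :=
  ∃ H₁ H₂ : C(I × I, Z),
    (∀ t, H₁ (0, t) = α₁ t) ∧ (∀ t, H₁ (1, t) = β₁ t) ∧ (∀ s, H₁ (s, 0) = H₁ (s, 1)) ∧
    (∀ t, H₂ (0, t) = α₂ t) ∧ (∀ t, H₂ (1, t) = β₂ t) ∧ (∀ s, H₂ (s, 0) = H₂ (s, 1)) ∧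
    ∀ s, H₁ (s, 0) = H₂ (s, 0)

/-! ### The group of orientation preserving isometries of the hyperbolic plane -/

/-- The action of `PSL(2, ℝ)` on the upper half plane by Möbius transformations. -/
instance pslAction : MulAction PSL(2, ℝ) ℍ :=
  MulAction.compHom ℍ (Matrix.ProjectiveSpecialLinearGroup.toPGL (n := Fin 2) (R := ℝ))

theorem psl_mk_smul (A : SL(2, ℝ)) (z : ℍ) : (QuotientGroup.mk A : PSL(2, ℝ)) • z = A • z :=
  rfl

instance psl_isIsometricSMul : IsIsometricSMul PSL(2, ℝ) ℍ where
  isometry_smul g := by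
    obtain ⟨A, rfl⟩ := QuotientGroup.mk_surjective g
    exact isometry_smul ℍ A

/-! ### Hyperbolic surfaces -/

/-- A connected, oriented, complete hyperbolic surface of finite area with (possibly empty) totally
geodesic boundary consisting of closed geodesics, given as the quotient of its universal cover by
its group of deck transformations. The universal cover is a closed convex region of the hyperbolic
plane bounded by complete geodesics; it is the whole plane when the surface has no boundary. Cusps
are allowed. By the Gauss-Bonnet theorem the Euler characteristic of the surface is automatically
negative. -/
structure HyperbolicSurface where
  /-- The group of deck transformations. -/
  Γ : Subgroup PSL(2, ℝ)
  /-- The universal cover, a region of `ℍ` invariant under `Γ`. -/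
  cover : SubMulAction Γ ℍ
  properlyDiscontinuous : ProperlyDiscontinuousSMul Γ ℍ
  free : ∀ (γ : Γ) (z : ℍ), γ • z = z → γ = 1
  isClosed : IsClosed (cover : Set ℍ)
  interior_nonempty : (interior (cover : Set ℍ)).Nonempty
  /-- The region contains the geodesic segment between any two of its points. -/
  convex : ∀ c : ℝ → ℍ, Isometry c → (c ⁻¹' (cover : Set ℍ)).OrdConnected
  /-- Every boundary point lies on a complete geodesic contained in the boundary which projects to
  a closed geodesic of the surface. -/
  boundary : ∀ z ∈ frontier (cover : Set ℍ), ∃ c : ℝ → ℍ, Isometry c ∧ c 0 = z ∧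
    Set.range c ⊆ frontier (cover : Set ℍ) ∧
    ∃ γ : Γ, ∃ ℓ : ℝ, 0 < ℓ ∧ ∀ t, γ • c t = c (t + ℓ)
  /-- The quotient has finite area: some set of finite hyperbolic area meets every orbit. -/
  finite_area : ∃ S : Set ℍ, volume S < ⊤ ∧ ∀ z ∈ cover, ∃ γ : Γ, γ • z ∈ S

namespace HyperbolicSurface

/-- The surface itself, that is the space of `Γ`-orbits in the universal cover. Its topology is the
quotient topology. -/
abbrev Pt (X : HyperbolicSurface) : Type := Quotient (MulAction.orbitRel X.Γ X.cover)

/-- The universal covering map. -/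
def proj (X : HyperbolicSurface) (z : X.cover) : X.Pt := Quotient.mk _ z

theorem continuous_proj (X : HyperbolicSurface) : Continuous X.proj := continuous_quotient_mk'

/-- `c` is a lift of the curve `γ` in the surface to a unit speed geodesic of the hyperbolic plane
(parametrized by the whole real line). -/
structure IsGeodesicLift (X : HyperbolicSurface) (γ : ℝ → X.Pt) (c : ℝ → X.cover) : Prop where
  isometry : Isometry c
  proj_eq : ∀ t, X.proj (c t) = γ t

theorem IsGeodesicLift.smul {X : HyperbolicSurface} {γ : ℝ → X.Pt} {c : ℝ → X.cover}
    (h : X.IsGeodesicLift γ c) (k : X.Γ) : X.IsGeodesicLift γ (fun t => k • c t) where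
  isometry := Isometry.of_dist_eq fun s t => by
    have := h.isometry.dist_eq s t
    rw [← this]
    exact dist_smul (k : PSL(2, ℝ)) (c s : ℍ) (c t : ℍ)
  proj_eq t := by
    rw [← h.proj_eq t]
    exact Quotient.sound ⟨k, rfl⟩

/-- The direction of a curve in the universal cover at time `t`, as a tangent vector of the upper
half plane. -/
def direction {X : HyperbolicSurface} (c : ℝ → X.cover) (t : ℝ) : ℂ :=
  deriv (fun u => ((c u : ℍ) : ℂ)) t

/-- An oriented closed geodesic of a hyperbolic surface, parametrized by arc length. The length
`length` need not be the least period, so geodesics that traverse another closed geodesic several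
times are included. -/
structure ClosedGeodesic (X : HyperbolicSurface) where
  toFun : ℝ → X.Pt
  length : ℝ
  length_pos : 0 < length
  periodic : Function.Periodic toFun length
  isGeodesic : ∃ c, X.IsGeodesicLift toFun c

namespace ClosedGeodesic

variable {X : HyperbolicSurface}

theorem continuous (x : X.ClosedGeodesic) : Continuous x.toFun := by
  obtain ⟨c, hc⟩ := x.isGeodesic
  have : x.toFun = X.proj ∘ c := funext fun t => (hc.proj_eq t).symm
  rw [this]
  exact X.continuous_proj.comp hc.isometry.continuous

/-- The loop that starts at `x(s)` and runs once along `x` in its positive direction. -/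
def loopAt (x : X.ClosedGeodesic) (s : ℝ) : Path (x.toFun s) (x.toFun s) where
  toFun u := x.toFun (s + u * x.length)
  continuous_toFun := x.continuous.comp (by fun_prop)
  source' := by simp
  target' := by simpa using x.periodic s

end ClosedGeodesic

/-- An intersection point of two oriented closed geodesics, recorded by the two parameters at which
the geodesics pass through it. -/
structure IntersectionPoint {X : HyperbolicSurface} (x y : X.ClosedGeodesic) where
  s : ℝ
  t : ℝ
  eq : x.toFun s = y.toFun t

namespace IntersectionPoint

variable {X : HyperbolicSurface} {x y : X.ClosedGeodesic}

/-- The point of the surface. -/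
def point (p : IntersectionPoint x y) : X.Pt := x.toFun p.s

/-- The first geodesic as a loop based at the intersection point. -/
def loopFst (p : IntersectionPoint x y) : Path p.point p.point := x.loopAt p.s

/-- The second geodesic as a loop based at the intersection point. -/
def loopSnd (p : IntersectionPoint x y) : Path p.point p.point := (y.loopAt p.t).cast p.eq p.eq

/-- The loop product `x *ₚ y`: first `x`, then `y`, both based at `p`. -/
def loopProduct (p : IntersectionPoint x y) : Path p.point p.point := p.loopFst.trans p.loopSnd

/-- Over an intersection point the two geodesics have lifts to the hyperbolic plane that meet at
the corresponding parameters. -/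
theorem exists_lifts (p : IntersectionPoint x y) :
    ∃ c : (ℝ → X.cover) × (ℝ → X.cover),
      X.IsGeodesicLift x.toFun c.1 ∧ X.IsGeodesicLift y.toFun c.2 ∧ c.1 p.s = c.2 p.t := by
  obtain ⟨c, hc⟩ := x.isGeodesic
  obtain ⟨d, hd⟩ := y.isGeodesic
  have h : X.proj (c p.s) = X.proj (d p.t) := by rw [hc.proj_eq, hd.proj_eq, p.eq]
  obtain ⟨k, hk⟩ := Quotient.exact h
  exact ⟨(c, fun t => k • d t), hc, hd.smul k, hk.symm⟩

/-- The angle in `[0, π]` between the positive directions of the two geodesics at the intersection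
point. It is measured between lifts that meet over the point; the hyperbolic metric is conformal to
the Euclidean one, and since deck transformations are conformal the choice of lifts is
immaterial. -/
def angle (p : IntersectionPoint x y) : ℝ :=
  InnerProductGeometry.angle (direction p.exists_lifts.choose.1 p.s)
    (direction p.exists_lifts.choose.2 p.t)

/-- The natural identification between intersection points on two surfaces `X` and `Y` along a
homeomorphism `ψ : X → Y`: the geodesics based at `p`, carried over by `ψ`, are simultaneously
freely homotopic to the geodesics based at `p'`. -/
def CorrespondsTo {Y : HyperbolicSurface} {x' y' : Y.ClosedGeodesic}
    (p : IntersectionPoint x y) (ψ : X.Pt ≃ₜ Y.Pt) (p' : IntersectionPoint x' y') : Prop :=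
  SimultaneouslyFreelyHomotopic (p.loopFst.map ψ.continuous) (p.loopSnd.map ψ.continuous)
    p'.loopFst p'.loopSnd

end IntersectionPoint

/-- `x'` is the geodesic in `Y` that represents the free homotopy class of `x`, where the classes of
the two surfaces are identified along `ψ`. -/
def ClosedGeodesic.IsRepresentative {X Y : HyperbolicSurface} (x : X.ClosedGeodesic)
    (ψ : X.Pt ≃ₜ Y.Pt) (x' : Y.ClosedGeodesic) : Prop :=
  FreelyHomotopic ((x.loopAt 0).map ψ.continuous) (x'.loopAt 0)

end HyperbolicSurface

/-- A marked hyperbolic surface `(X, φ)`, `φ : F → X`, representing a point of the Teichmüller space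
of `F`. Two of them represent the same point if an isometry `X₁ → X₂` carries one marking to the
other up to homotopy. -/
structure MarkedHyperbolicSurface (F : Type*) [TopologicalSpace F] extends HyperbolicSurface where
  marking : F ≃ₜ toHyperbolicSurface.Pt

/-- The change of marking `φ_Y ∘ φ_X⁻¹ : X → Y`. -/
def MarkedHyperbolicSurface.change {F : Type*} [TopologicalSpace F]
    (X Y : MarkedHyperbolicSurface F) : X.Pt ≃ₜ Y.Pt :=
  X.marking.symm.trans Y.marking

end

/-!
The loop product at an intersection point `p` of two closed geodesics `x`, `y` of lengths `a`, `b`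
has a holonomy: the product `γ * δ` of the deck transformations that translate lifts of `x` and `y`
along themselves, the lifts being chosen to meet over `p`. Two facts about it give the theorem.

* The conjugacy class of the holonomy depends only on the free homotopy class of the loop, because
  homotopies lift to the universal cover (`IsHolonomy.of_freelyHomotopic`, `IsHolonomy.isConj`), and
  a simultaneous free homotopy of a pair of loops preserves the holonomies of both loops read off
  from a common base point (`IsPairHolonomy.of_simultaneouslyFreelyHomotopic`). Carrying the loop
  products from `Y` back along `X → Y`, where they are freely homotopic by hypothesis, shows that
  the holonomies at `p'` and `q'` are conjugate.
* The trace of the holonomy determines the angle. Every geodesic line is the image of the imaginary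
  axis under some `g ∈ SL(2, ℝ)` (`UpperHalfPlane.exists_smul_axisPoint_of_isometry`), so that `γ`
  and `δ` are conjugates of diagonal matrices, and two lines through one point differ by a
  rotation. By `UpperHalfPlane.trace_axisTranslation_mul` and `UpperHalfPlane.angle_axis` the trace
  is `2 (cosh (a / 2) cosh (b / 2) + sinh (a / 2) sinh (b / 2) cos θ)`. This is at least
  `2 cosh ((a - b) / 2) > 0`, so passing to `PSL(2, ℝ)` loses no sign, and it is strictly monotone
  in `cos θ`.
-/

/-! ### Holonomy of loops under quotient coverings -/

section Holonomy

variable {E B G : Type*} [TopologicalSpace E] [TopologicalSpace B] [Group G] [MulAction G E]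

/-- `g` is a holonomy of the loop `α` under the quotient map `f` of a `G`-action: some lift of `α`
ends at the `g`-translate of its starting point. -/
def IsHolonomy (f : E → B) {b : B} (α : Path b b) (g : G) : Prop :=
  ∃ A : C(I, E), (∀ t, f (A t) = α t) ∧ A 1 = g • A 0

/-- `(g, h)` is a holonomy of the pair `(α, β)` of loops with the same base point: `g` and `h` are
read off from lifts of `α` and `β` with the same starting point. -/
def IsPairHolonomy (f : E → B) {b : B} (α β : Path b b) (g h : G) : Prop :=
  ∃ A₁ A₂ : C(I, E), (∀ t, f (A₁ t) = α t) ∧ (∀ t, f (A₂ t) = β t) ∧ A₁ 0 = A₂ 0 ∧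
    A₁ 1 = g • A₁ 0 ∧ A₂ 1 = h • A₂ 0

theorem SimultaneouslyFreelyHomotopic.symm {a b : B} {α₁ α₂ : Path a a} {β₁ β₂ : Path b b}
    (h : SimultaneouslyFreelyHomotopic α₁ α₂ β₁ β₂) :
    SimultaneouslyFreelyHomotopic β₁ β₂ α₁ α₂ := by
  obtain ⟨H₁, H₂, h₁, h₂, h₃, h₄, h₅, h₆, h₇⟩ := h
  let r : C(I × I, I × I) := ⟨fun p => (unitInterval.symm p.1, p.2), by fun_prop⟩
  exact ⟨H₁.comp r, H₂.comp r, by simp [r, h₂], by simp [r, h₁], fun s => by simp [r, h₃],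
    by simp [r, h₅], by simp [r, h₄], fun s => by simp [r, h₆], fun s => by simp [r, h₇]⟩

theorem FreelyHomotopic.map {a b : E} {α : Path a a} {β : Path b b} (h : FreelyHomotopic α β)
    {f : E → B} (hf : Continuous f) : FreelyHomotopic (α.map hf) (β.map hf) := by
  obtain ⟨H, h₀, h₁, h₂⟩ := h
  exact ⟨(ContinuousMap.mk f hf).comp H, by simp [h₀], by simp [h₁], fun s => by simp [h₂]⟩

variable {f : E → B}

/-- A homotopy through loops lifts to a homotopy through paths whose endpoints all differ by the
same deck transformation. -/
theorem IsQuotientCoveringMap.exists_lift_homotopy (hf : IsQuotientCoveringMap f G)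
    (H : C(I × I, B)) (hH : ∀ s, H (s, 0) = H (s, 1)) (A : C(I, E))
    (hA : ∀ t, H (0, t) = f (A t)) {g : G} (hg : A 1 = g • A 0) :
    ∃ L : C(I × I, E), (∀ z, f (L z) = H z) ∧ (∀ t, L (0, t) = A t) ∧
      ∀ s, L (s, 1) = g • L (s, 0) := by
  have := hf.toContinuousConstSMul
  have cov := hf.isCoveringMap
  let L := cov.liftHomotopy H A hA
  have hL : ∀ z, f (L z) = H z := congr_fun (cov.liftHomotopy_lifts H A hA)
  have hL0 : ∀ t, L (0, t) = A t := cov.liftHomotopy_zero H A hA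
  refine ⟨L, hL, hL0, fun s => ?_⟩
  have key : (fun s => L (s, 1)) = fun s => g • L (s, 0) := by
    refine cov.eq_of_comp_eq (by fun_prop) ((by fun_prop : Continuous fun s => L (s, 0)).const_smul g)
      (funext fun s => ?_) 0 ?_
    · simp [hf.map_smul, hL, hH]
    · simp [hL0, hg]
  exact congr_fun key s

theorem IsHolonomy.of_freelyHomotopic (hf : IsQuotientCoveringMap f G) {a b : B} {α : Path a a}
    {β : Path b b} {g : G} (hα : IsHolonomy f α g) (h : FreelyHomotopic α β) :
    IsHolonomy f β g := by
  obtain ⟨A, hA, hg⟩ := hα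
  obtain ⟨H, h₀, h₁, hH⟩ := h
  obtain ⟨L, hL, -, hLg⟩ := hf.exists_lift_homotopy H hH A (fun t => by rw [h₀, hA]) hg
  exact ⟨L.comp (.prodMk (.const I 1) (.id I)), fun t => by simp [hL, h₁], by simp [hLg]⟩

theorem IsPairHolonomy.of_simultaneouslyFreelyHomotopic (hf : IsQuotientCoveringMap f G) {a b : B}
    {α₁ α₂ : Path a a} {β₁ β₂ : Path b b} {g h : G} (hα : IsPairHolonomy f α₁ α₂ g h)
    (hαβ : SimultaneouslyFreelyHomotopic α₁ α₂ β₁ β₂) : IsPairHolonomy f β₁ β₂ g h := by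
  obtain ⟨A₁, A₂, hA₁, hA₂, h0, hg, hh⟩ := hα
  obtain ⟨H₁, H₂, h₁, h₁', hH₁, h₂, h₂', hH₂, hb⟩ := hαβ
  obtain ⟨L₁, hL₁, hL₁0, hL₁g⟩ := hf.exists_lift_homotopy H₁ hH₁ A₁ (fun t => by rw [h₁, hA₁]) hg
  obtain ⟨L₂, hL₂, hL₂0, hL₂h⟩ := hf.exists_lift_homotopy H₂ hH₂ A₂ (fun t => by rw [h₂, hA₂]) hh
  -- the two lifts of the common track of base points agree
  have key : (fun s => L₁ (s, 0)) = fun s => L₂ (s, 0) :=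
    hf.isCoveringMap.eq_of_comp_eq (by fun_prop) (by fun_prop)
      (funext fun s => by simp [hL₁, hL₂, hb]) 0 (by simp [hL₁0, hL₂0, h0])
  exact ⟨L₁.comp (.prodMk (.const I 1) (.id I)), L₂.comp (.prodMk (.const I 1) (.id I)),
    fun t => by simp [hL₁, h₁'], fun t => by simp [hL₂, h₂'], by simpa using congr_fun key 1,
    by simp [hL₁g], by simp [hL₂h]⟩

theorem IsPairHolonomy.trans (hf : IsQuotientCoveringMap f G) {b : B} {α β : Path b b} {g h : G}
    (hαβ : IsPairHolonomy f α β g h) : IsHolonomy f (α.trans β) (g * h) := by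
  have := hf.toContinuousConstSMul
  obtain ⟨A₁, A₂, hA₁, hA₂, h0, hg, hh⟩ := hαβ
  let P₁ : Path (A₁ 0) (g • A₁ 0) := ⟨A₁, rfl, hg⟩
  let P₂ : Path (g • A₁ 0) ((g * h) • A₁ 0) :=
    ⟨⟨fun t => g • A₂ t, A₂.continuous.const_smul g⟩, by simp [h0], by simp [hh, h0, mul_smul]⟩
  refine ⟨(P₁.trans P₂).toContinuousMap, fun t => ?_, by simp⟩
  simp only [Path.coe_toContinuousMap, Path.trans_apply]
  split_ifs
  · exact hA₁ _
  · exact (hf.map_smul g).trans (hA₂ _)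

theorem IsHolonomy.isConj (hf : IsQuotientCoveringMap f G) {b : B} {α : Path b b} {g g' : G}
    (h : IsHolonomy f α g) (h' : IsHolonomy f α g') : IsConj g g' := by
  have := hf.toContinuousConstSMul
  have := hf.isCancelSMul
  obtain ⟨A, hA, hg⟩ := h
  obtain ⟨A', hA', hg'⟩ := h'
  obtain ⟨k, hk⟩ := hf.apply_eq_iff_mem_orbit.1 ((hA' 0).trans (hA 0).symm)
  simp only at hk
  have key : ⇑A' = fun t => k • A t :=
    hf.isCoveringMap.eq_of_comp_eq A'.continuous (A.continuous.const_smul k)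
      (funext fun t => by simp [hf.map_smul, hA, hA']) 0 hk.symm
  refine isConj_iff.2 ⟨k, mul_inv_eq_iff_eq_mul.2 (IsCancelSMul.right_cancel _ _ (A 0) ?_)⟩
  rw [mul_smul, mul_smul, hk, ← hg, ← hg', key]

end Holonomy

/-! ### Holonomy of intersection points -/

namespace HyperbolicSurface

variable (X : HyperbolicSurface)

theorem isQuotientCoveringMap_proj : IsQuotientCoveringMap X.proj X.Γ := by
  have := X.properlyDiscontinuous
  have : ContinuousConstSMul X.Γ X.cover := ⟨fun γ => by
    refine Continuous.subtype_mk (?_ : Continuous fun z : X.cover => (γ : PSL(2, ℝ)) • (z : ℍ)) _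
    exact (isometry_smul ℍ (γ : PSL(2, ℝ))).continuous.comp continuous_subtype_val⟩
  have : LocallyCompactSpace X.cover := X.isClosed.locallyCompactSpace
  have : T2Space X.cover := inferInstanceAs (T2Space (X.cover : Set ℍ))
  have : IsCancelSMul X.Γ X.cover := isCancelSMul_iff_eq_one_of_smul_eq.2 fun γ z h =>
    X.free γ z (congr_arg Subtype.val h)
  have : ProperlyDiscontinuousSMul X.Γ X.cover := ⟨fun {K M} hK hM => by
    refine (finite_disjoint_inter_image (Γ := X.Γ) (hK.image continuous_subtype_val)
      (hM.image continuous_subtype_val)).subset fun γ hγ => ?_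
    obtain ⟨_, ⟨z, hz, rfl⟩, hz'⟩ := hγ
    exact ⟨_, ⟨z, ⟨z, hz, rfl⟩, rfl⟩, _, hz', rfl⟩⟩
  exact isQuotientCoveringMap_quotientMk_of_properlyDiscontinuousSMul

variable {X}

/-- A lift of a closed geodesic is translated along itself by a deck transformation. -/
theorem ClosedGeodesic.exists_deck (x : X.ClosedGeodesic) {c : ℝ → X.cover}
    (hc : X.IsGeodesicLift x.toFun c) : ∃ γ : X.Γ, ∀ u, c (u + x.length) = γ • c u := by
  have hf := X.isQuotientCoveringMap_proj
  obtain ⟨γ, hγ⟩ := hf.apply_eq_iff_mem_orbit.1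
    (show X.proj (c (0 + x.length)) = X.proj (c 0) by
      rw [hc.proj_eq, hc.proj_eq, x.periodic])
  refine ⟨γ, congr_fun (hf.isCoveringMap.eq_of_comp_eq
    (hc.isometry.continuous.comp (by fun_prop)) (hc.smul γ).isometry.continuous
      (funext fun u => ?_) 0 hγ.symm)⟩
  simp [hf.map_smul, hc.proj_eq, x.periodic u]

theorem IntersectionPoint.isPairHolonomy {x y : X.ClosedGeodesic} (p : IntersectionPoint x y)
    {c d : ℝ → X.cover} (hc : X.IsGeodesicLift x.toFun c) (hd : X.IsGeodesicLift y.toFun d)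
    (hcd : c p.s = d p.t) {γ δ : X.Γ} (hγ : ∀ u, c (u + x.length) = γ • c u)
    (hδ : ∀ u, d (u + y.length) = δ • d u) :
    IsPairHolonomy X.proj p.loopFst p.loopSnd γ δ :=
  ⟨⟨fun u => c (p.s + u * x.length), hc.isometry.continuous.comp (by fun_prop)⟩,
    ⟨fun u => d (p.t + u * y.length), hd.isometry.continuous.comp (by fun_prop)⟩,
    fun _ => hc.proj_eq _, fun _ => hd.proj_eq _, by simpa using hcd, by simpa using hγ p.s,
    by simpa using hδ p.t⟩

end HyperbolicSurface

/-! ### Geodesics and translations of the hyperbolic plane -/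

namespace UpperHalfPlane

/-- The unit speed parametrization `u ↦ eᵘ i` of the imaginary axis. -/
noncomputable def axisPoint (u : ℝ) : ℍ := ⟨Real.exp u * Complex.I, by simp [Complex.exp_ofReal_re, Real.exp_pos]⟩

/-- The translation by `ℓ` along the imaginary axis. -/
noncomputable def axisTranslation (ℓ : ℝ) : SL(2, ℝ) :=
  ⟨!![Real.exp (ℓ / 2), 0; 0, Real.exp (-(ℓ / 2))], by simp [← Real.exp_add]⟩

theorem coe_axisPoint (u : ℝ) : (axisPoint u : ℂ) = Real.exp u * Complex.I := rfl

theorem axisPoint_re (u : ℝ) : (axisPoint u).re = 0 := by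
  rw [← coe_re, coe_axisPoint]; simp

theorem axisPoint_im (u : ℝ) : (axisPoint u).im = Real.exp u := by
  rw [← coe_im, coe_axisPoint]; simp [Complex.exp_ofReal_re]

theorem axisPoint_zero : axisPoint 0 = UpperHalfPlane.I := by
  ext; simp [coe_axisPoint]

theorem coe_sl_smul (g : SL(2, ℝ)) (z : ℍ) :
    ((g • z : ℍ) : ℂ) = (g 0 0 * z + g 0 1) / (g 1 0 * z + g 1 1) :=
  coe_specialLinearGroup_apply g z

theorem sl_denom_ne_zero (g : SL(2, ℝ)) (z : ℍ) : (g 1 0 * z + g 1 1 : ℂ) ≠ 0 :=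
  denom_ne_zero (g : GL (Fin 2) ℝ) z

theorem sl_det (g : SL(2, ℝ)) : g 0 0 * g 1 1 - g 0 1 * g 1 0 = 1 := by
  rw [← Matrix.det_fin_two]; exact g.det_coe

theorem axisTranslation_smul (ℓ u : ℝ) :
    axisTranslation ℓ • axisPoint u = axisPoint (u + ℓ) := by
  ext
  have h : (Real.exp (-(ℓ / 2)) : ℂ) ≠ 0 := mod_cast (Real.exp_pos _).ne'
  rw [coe_sl_smul, coe_axisPoint, coe_axisPoint]
  simp only [axisTranslation, Matrix.SpecialLinearGroup.coe_mk, Matrix.of_apply,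
    Matrix.cons_val', Matrix.cons_val_zero, Matrix.cons_val_one, Matrix.cons_val_fin_one]
  simp only [Complex.ofReal_zero, zero_mul, zero_add, add_zero]
  rw [div_eq_iff h, show Real.exp (u + ℓ) = Real.exp (ℓ / 2) * Real.exp u * Real.exp (ℓ / 2) by
    rw [← Real.exp_add, ← Real.exp_add]; ring_nf]
  have : (Real.exp (ℓ / 2) : ℂ) * Real.exp (-(ℓ / 2)) = 1 := by
    norm_cast; simp [← Real.exp_add]
  push_cast at this ⊢
  linear_combination (-(Complex.exp u * Complex.I * Complex.exp (ℓ / 2))) * this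

/-- The stabilizer of `i` consists of rotations. -/
theorem sl_smul_I_eq_iff {k : SL(2, ℝ)} : k • UpperHalfPlane.I = UpperHalfPlane.I ↔ k 1 1 = k 0 0 ∧ k 1 0 = -k 0 1 := by
  rw [UpperHalfPlane.ext_iff, coe_sl_smul, div_eq_iff (sl_denom_ne_zero k _), Complex.ext_iff]
  simp only [coe_I, Complex.add_re, Complex.add_im, Complex.mul_re, Complex.mul_im, Complex.I_re,
    Complex.I_im, Complex.ofReal_re, Complex.ofReal_im]
  constructor
  · rintro ⟨h₁, h₂⟩; constructor <;> linarith
  · rintro ⟨h₁, h₂⟩; constructor <;> linarith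

/-- A Möbius transformation that fixes two points of the imaginary axis is trivial. -/
theorem mk_eq_one_of_fixes_axisPoint {k : SL(2, ℝ)} (h₀ : k • axisPoint 0 = axisPoint 0)
    (h₁ : k • axisPoint 1 = axisPoint 1) : (QuotientGroup.mk k : PSL(2, ℝ)) = 1 := by
  rw [axisPoint_zero, sl_smul_I_eq_iff] at h₀
  obtain ⟨h11, h10⟩ := h₀
  rw [UpperHalfPlane.ext_iff, coe_sl_smul, div_eq_iff (sl_denom_ne_zero k _), Complex.ext_iff,
    coe_axisPoint] at h₁
  have h01 := h₁.1
  simp only [Complex.add_re, Complex.mul_re, Complex.mul_im, Complex.I_re, Complex.I_im,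
    Complex.ofReal_re, Complex.ofReal_im, Complex.add_im, h10, h11] at h01
  have he : 1 < Real.exp 1 := by simp
  have h01' : k 0 1 = 0 := by
    have : k 0 1 * (Real.exp 1 ^ 2 - 1) = 0 := by linear_combination -h01
    rcases mul_eq_zero.1 this with h | h
    · exact h
    · nlinarith
  rw [QuotientGroup.eq_one_iff, Matrix.SpecialLinearGroup.mem_center_iff]
  refine ⟨k 0 0, ?_, ?_⟩
  · have := sl_det k
    simp only [h11, h01', Fintype.card_fin] at this ⊢
    linarith
  · ext i j
    fin_cases i <;> fin_cases j <;> simp [h11, h10, h01']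

/-- A point of the imaginary axis is determined by its distances to `i` and `e i`; these are given
through `cosh`, so that the parameter `t` may be negative. -/
theorem eq_axisPoint_of_dist {z : ℍ} {t : ℝ} (h₀ : Real.cosh (dist z (axisPoint 0)) = Real.cosh t)
    (h₁ : Real.cosh (dist z (axisPoint 1)) = Real.cosh (t - 1)) : z = axisPoint t := by
  rw [cosh_dist', axisPoint_re, axisPoint_im, div_eq_iff (by have := z.im_pos; positivity)] at h₀ h₁
  rw [Real.exp_zero] at h₀
  have hy := z.im_pos
  have het : Real.exp (-t) * Real.exp t = 1 := by simp [← Real.exp_add]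
  have he : Real.exp (-1) * Real.exp 1 = 1 := by simp [← Real.exp_add]
  have he1 : 1 < Real.exp 1 := by simp
  rw [Real.cosh_eq] at h₀ h₁
  rw [show t - 1 = t + -1 by ring, show -(t + -1) = -t + 1 by ring, Real.exp_add, Real.exp_add]
    at h₁
  set T := Real.exp t
  set T' := Real.exp (-t)
  set e := Real.exp 1
  set e' := Real.exp (-1)
  have hT : 0 < T := Real.exp_pos _
  -- the difference of the two distance equations is linear in the coordinates of `z`
  have key : (1 - e ^ 2) * (1 - z.im * T') = 0 := by
    linear_combination h₀ - h₁ - z.im * T * he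
  have hz : z.im = T := by
    rcases mul_eq_zero.1 key with h | h
    · nlinarith
    · have : z.im * T' * T = T := by rw [show z.im * T' = 1 by linarith, one_mul]
      linear_combination this - z.im * het
  have hre : z.re = 0 := by
    rw [hz] at h₀
    have : z.re ^ 2 = 0 := by linear_combination h₀ + het
    exact pow_eq_zero_iff two_ne_zero |>.1 this
  rw [UpperHalfPlane.ext_iff, Complex.ext_iff]
  simp [coe_axisPoint, hz, hre, T, Complex.exp_ofReal_re]


/-- Rotations about `i` act transitively on the hyperbolic circle of radius `1` around `i`. -/
theorem exists_rotation_smul_axisPoint {w : ℍ} (hw : dist w UpperHalfPlane.I = 1) :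
    ∃ k : SL(2, ℝ), k • UpperHalfPlane.I = UpperHalfPlane.I ∧ k • axisPoint 1 = w := by
  have hc := cosh_dist' w UpperHalfPlane.I
  have hy := w.im_pos
  rw [hw, eq_div_iff (by simpa using hy.ne')] at hc
  simp only [I_re, I_im] at hc
  have hs : 0 < Real.sinh 1 := Real.sinh_pos_iff.2 one_pos
  have hcs : Real.cosh 1 ^ 2 - Real.sinh 1 ^ 2 = 1 := Real.cosh_sq_sub_sinh_sq 1
  have he : Real.cosh 1 + Real.sinh 1 = Real.exp 1 := Real.cosh_add_sinh 1
  -- a rotation with entries `α`, `β` turns directions at `i` by twice its angle, so `α + β i` has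
  -- to be a square root of the unit complex number that gives the direction of `w` as seen from `i`
  obtain ⟨v, hv⟩ := IsAlgClosed.exists_pow_nat_eq
    (⟨(Real.cosh 1 - 1 / w.im) / Real.sinh 1, -(w.re / (w.im * Real.sinh 1))⟩ : ℂ) two_pos
  obtain ⟨α, β⟩ := v
  have h₁ : α ^ 2 - β ^ 2 = (Real.cosh 1 - 1 / w.im) / Real.sinh 1 := by
    have := congr_arg Complex.re hv
    simp only [sq, Complex.mul_re] at this
    linarith
  have h₂ : 2 * α * β = -(w.re / (w.im * Real.sinh 1)) := by
    have := congr_arg Complex.im hv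
    simp only [sq, Complex.mul_im] at this
    linarith
  have h₃ : α ^ 2 + β ^ 2 = 1 := by
    refine (sq_eq_sq₀ (by positivity) one_pos.le).1 ?_
    rw [show (α ^ 2 + β ^ 2) ^ 2 = (α ^ 2 - β ^ 2) ^ 2 + (2 * α * β) ^ 2 by ring, h₁, h₂]
    field_simp
    linear_combination w.im ^ 2 * hcs - hc
  have h₄ : w.im * (α ^ 2 - β ^ 2) * Real.sinh 1 = w.im * Real.cosh 1 - 1 := by
    rw [h₁]; field_simp
  have h₅ : w.im * (2 * α * β) * Real.sinh 1 = -w.re := by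
    rw [h₂]; field_simp
  set e := Real.exp 1
  set C := Real.cosh 1
  set S := Real.sinh 1
  have heS : e * (C - S) = 1 := by rw [← he]; linear_combination hcs
  have hD : w.im * (α ^ 2 + β ^ 2 * e ^ 2) = e := by
    linear_combination (-w.im * α ^ 2) * heS - w.im * β ^ 2 * e * he + e * (w.im * C * h₃ - h₄)
  have hx : w.re * (α ^ 2 + β ^ 2 * e ^ 2) = α * β * (1 - e ^ 2) := by
    linear_combination (α ^ 2 + β ^ 2 * e ^ 2) * h₅ - 2 * α * β * S * hD + α * β * heS - α * β * e * he
  have hD0 : α ^ 2 + β ^ 2 * e ^ 2 ≠ 0 := fun h => by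
    rw [h, mul_zero] at hD; exact (Real.exp_pos 1).ne hD
  let k : SL(2, ℝ) := ⟨!![α, β; -β, α], by rw [Matrix.det_fin_two_of]; linarith⟩
  refine ⟨k, sl_smul_I_eq_iff.2 ⟨rfl, rfl⟩, ?_⟩
  rw [UpperHalfPlane.ext_iff, coe_sl_smul, div_eq_iff (sl_denom_ne_zero k _), Complex.ext_iff,
    coe_axisPoint]
  simp only [k, Matrix.of_apply, Matrix.cons_val',
    Matrix.cons_val_zero, Matrix.cons_val_one, Matrix.cons_val_fin_one, Complex.add_re,
    Complex.add_im, Complex.mul_re, Complex.mul_im, Complex.I_re, Complex.I_im,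
    Complex.ofReal_re, Complex.ofReal_im, coe_re, coe_im]
  constructor
  · refine mul_right_cancel₀ hD0 ?_
    linear_combination (-α) * hx - β * e * hD + β * e ^ 2 * h₃
  · refine mul_right_cancel₀ hD0 ?_
    linear_combination (-α) * hD + β * e * hx + α * e * h₃

/-- Every unit speed geodesic line of the hyperbolic plane is the image of the imaginary axis under
a Möbius transformation. -/
theorem exists_smul_axisPoint_of_isometry {c : ℝ → ℍ} (hc : Isometry c) (s : ℝ) :
    ∃ g : SL(2, ℝ), ∀ u, c (s + u) = g • axisPoint u := by
  obtain ⟨g₀, hg₀⟩ := MulAction.exists_smul_eq SL(2, ℝ) UpperHalfPlane.I (c s)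
  obtain ⟨k, hk, hk'⟩ := exists_rotation_smul_axisPoint (w := g₀⁻¹ • c (s + 1)) (by
    rw [← dist_smul g₀, smul_inv_smul, hg₀, hc.dist_eq]; simp)
  have h (u r : ℝ) (hr : (g₀ * k) • axisPoint r = c (s + r)) :
      Real.cosh (dist ((g₀ * k)⁻¹ • c (s + u)) (axisPoint r)) = Real.cosh (u - r) := by
    rw [← dist_smul (g₀ * k), smul_inv_smul, hr, hc.dist_eq, Real.dist_eq, Real.cosh_abs]
    congr 1; ring
  refine ⟨g₀ * k, fun u => (inv_smul_eq_iff.1 (eq_axisPoint_of_dist ?_ ?_))⟩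
  · rw [h u 0 (by rw [axisPoint_zero, mul_smul, hk, hg₀, add_zero]), sub_zero]
  · exact h u 1 (by rw [mul_smul, hk', smul_inv_smul])

/-- An isometry that translates the geodesic `u ↦ g • eᵘ i` by `ℓ` is the conjugate by `g` of the
translation along the imaginary axis. -/
theorem eq_mk_axisTranslation {γ : PSL(2, ℝ)} {g : SL(2, ℝ)} {ℓ : ℝ}
    (h : ∀ u, γ • g • axisPoint u = g • axisPoint (u + ℓ)) :
    γ = QuotientGroup.mk (g * axisTranslation ℓ * g⁻¹) := by
  obtain ⟨A, rfl⟩ := QuotientGroup.mk_surjective γ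
  have key (u : ℝ) : ((g * axisTranslation ℓ)⁻¹ * (A * g)) • axisPoint u = axisPoint u := by
    rw [mul_smul, inv_smul_eq_iff, mul_smul, mul_smul, axisTranslation_smul]
    exact h u
  have := mk_eq_one_of_fixes_axisPoint (key 0) (key 1)
  rw [QuotientGroup.mk_mul, QuotientGroup.mk_inv, inv_mul_eq_one] at this
  calc (QuotientGroup.mk A : PSL(2, ℝ))
      = QuotientGroup.mk (A * g) * (QuotientGroup.mk g)⁻¹ := by
        rw [QuotientGroup.mk_mul, mul_inv_cancel_right]
    _ = _ := by rw [← this]; rfl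

/-- The trace of an element of `PSL(2, ℝ)` is well defined up to sign and a conjugacy invariant. -/
theorem trace_sq_eq_of_isConj_mk {M N : SL(2, ℝ)}
    (h : IsConj (QuotientGroup.mk M : PSL(2, ℝ)) (QuotientGroup.mk N)) :
    (M : Matrix (Fin 2) (Fin 2) ℝ).trace ^ 2 = (N : Matrix (Fin 2) (Fin 2) ℝ).trace ^ 2 := by
  obtain ⟨k, hk⟩ := isConj_iff.1 h
  obtain ⟨K, rfl⟩ := QuotientGroup.mk_surjective k
  rw [← QuotientGroup.mk_inv, ← QuotientGroup.mk_mul, ← QuotientGroup.mk_mul, QuotientGroup.eq,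
    Matrix.SpecialLinearGroup.mem_center_iff] at hk
  obtain ⟨r, hr, hZ⟩ := hk
  have hN : N = K * M * K⁻¹ * ((K * M * K⁻¹)⁻¹ * N) := by group
  have hKM : ((K * M * K⁻¹ : SL(2, ℝ)) : Matrix (Fin 2) (Fin 2) ℝ).trace
      = (M : Matrix (Fin 2) (Fin 2) ℝ).trace := by
    rw [Matrix.SpecialLinearGroup.coe_mul, Matrix.trace_mul_comm,
      ← Matrix.SpecialLinearGroup.coe_mul, inv_mul_cancel_left]
  rw [hN, Matrix.SpecialLinearGroup.coe_mul, ← hZ, ← hKM, Matrix.scalar_apply,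
    ← Matrix.smul_eq_mul_diagonal, Matrix.trace_smul, smul_eq_mul, mul_pow]
  simp only [Fintype.card_fin] at hr
  rw [hr, one_mul]

/-- The trace of the product of the translations by `a` and `b` along two axes through `i`, the
second of which is the image of the first under the rotation `k`. -/
theorem trace_axisTranslation_mul {k : SL(2, ℝ)} (hk : k • UpperHalfPlane.I = UpperHalfPlane.I)
    (a b : ℝ) :
    ((axisTranslation a * (k * axisTranslation b * k⁻¹) : SL(2, ℝ)) :
      Matrix (Fin 2) (Fin 2) ℝ).trace =
      2 * Real.cosh ((a - b) / 2) +
        2 * k 0 0 ^ 2 * (Real.cosh ((a + b) / 2) - Real.cosh ((a - b) / 2)) := by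
  obtain ⟨h11, h10⟩ := sl_smul_I_eq_iff.1 hk
  have hdet := sl_det k
  rw [h11, h10] at hdet
  rw [Matrix.SpecialLinearGroup.coe_mul, Matrix.SpecialLinearGroup.coe_mul,
    Matrix.SpecialLinearGroup.coe_mul, Matrix.SpecialLinearGroup.coe_inv]
  simp only [Matrix.trace_fin_two, Matrix.mul_apply, Fin.sum_univ_two, Matrix.adjugate_fin_two,
    axisTranslation, Matrix.of_apply, Matrix.cons_val', Matrix.cons_val_zero,
    Matrix.cons_val_one, Matrix.cons_val_fin_one, h11, h10]
  rw [show (a - b) / 2 = a / 2 + -(b / 2) by ring, show (a + b) / 2 = a / 2 + b / 2 by ring,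
    Real.cosh_eq, Real.cosh_eq, neg_add, neg_add, neg_neg]
  simp only [Real.exp_add, neg_neg]
  linear_combination (Real.exp (a / 2) * Real.exp (-(b / 2)) +
    Real.exp (-(a / 2)) * Real.exp (b / 2)) * hdet

theorem hasDerivAt_smul_axisPoint (g : SL(2, ℝ)) :
    HasDerivAt (fun u => ((g • axisPoint u : ℍ) : ℂ))
      (Complex.I / (g 1 0 * Complex.I + g 1 1) ^ 2) 0 := by
  have hd := sl_denom_ne_zero g (axisPoint 0)
  simp only [coe_sl_smul, coe_axisPoint, Real.exp_zero, Complex.ofReal_one, one_mul] at hd ⊢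
  have he : HasDerivAt (fun u : ℝ => (Real.exp u : ℂ) * Complex.I) Complex.I 0 := by
    simpa using ((Real.hasDerivAt_exp 0).ofReal_comp).mul_const Complex.I
  have := ((he.const_mul (g 0 0 : ℂ)).add_const (g 0 1 : ℂ)).div
    ((he.const_mul (g 1 0 : ℂ)).add_const (g 1 1 : ℂ)) (by simpa using hd)
  refine this.congr_deriv ?_
  have hdet : (g 0 0 * g 1 1 - g 0 1 * g 1 0 : ℂ) = 1 := mod_cast sl_det g
  rw [Real.exp_zero, Complex.ofReal_one, one_mul]
  congr 1
  linear_combination Complex.I * hdet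

/-- The angle at `g • i` between the image of the imaginary axis under `g` and its image under
`g * k`, where `k` is a rotation about `i`. -/
theorem angle_axis {k : SL(2, ℝ)} (hk : k • UpperHalfPlane.I = UpperHalfPlane.I) (g : SL(2, ℝ)) :
    InnerProductGeometry.angle (Complex.I / (g 1 0 * Complex.I + g 1 1) ^ 2)
      (Complex.I / ((g * k) 1 0 * Complex.I + (g * k) 1 1) ^ 2)
      = Real.arccos (2 * k 0 0 ^ 2 - 1) := by
  obtain ⟨h11, h10⟩ := sl_smul_I_eq_iff.1 hk
  have hdet := sl_det k
  rw [h11, h10] at hdet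
  have hd : (g 1 0 * Complex.I + g 1 1 : ℂ) ≠ 0 := sl_denom_ne_zero g UpperHalfPlane.I
  set m : ℂ := g 1 0 * Complex.I + g 1 1 with hm
  set z : ℂ := k 0 0 + k 0 1 * Complex.I with hz
  set z' : ℂ := k 0 0 - k 0 1 * Complex.I with hz'
  have hdet' : (k 0 0 * k 0 0 + k 0 1 * k 0 1 : ℂ) = 1 := by
    have : k 0 0 * k 0 0 + k 0 1 * k 0 1 = 1 := by linarith
    exact mod_cast this
  have hzz : z * z' = 1 := by
    rw [hz, hz']; linear_combination hdet' - k 0 1 * k 0 1 * Complex.I_sq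
  have hz0 : z' ≠ 0 := right_ne_zero_of_mul_eq_one hzz
  have hgk : ((g * k) 1 0 * Complex.I + (g * k) 1 1 : ℂ) = m * z' := by
    simp only [Matrix.SpecialLinearGroup.coe_mul, Matrix.mul_apply, Fin.sum_univ_two, h10, h11]
    push_cast
    rw [hm, hz']; linear_combination g 1 0 * k 0 1 * Complex.I_sq
  rw [hgk, show Complex.I / (m * z') ^ 2 = Complex.I / m ^ 2 * z ^ 2 by
    rw [div_mul_eq_mul_div, div_eq_div_iff (by positivity) (by positivity)]
    linear_combination (-Complex.I * m ^ 2 * (z * z' + 1)) * hzz]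
  nth_rewrite 1 [← mul_one (Complex.I / m ^ 2)]
  rw [Complex.angle_mul_left (by simp [hd])]
  have hn : ‖z ^ 2‖ = 1 := by
    rw [norm_pow, Complex.sq_norm, Complex.normSq_apply]
    simp [hz]
    linarith
  rw [InnerProductGeometry.angle, hn]
  simp [hz, sq]
  congr 1
  linarith

end UpperHalfPlane

/-! ### The angle at an intersection point -/

namespace HyperbolicSurface

variable {X : HyperbolicSurface}

theorem direction_eq {c : ℝ → X.cover} {g : SL(2, ℝ)} {s : ℝ}
    (h : ∀ u, (c (s + u) : ℍ) = g • axisPoint u) :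
    direction c s = Complex.I / (g 1 0 * Complex.I + g 1 1) ^ 2 := by
  rw [direction, ← (hasDerivAt_smul_axisPoint g).deriv]
  simp only [← h]
  rw [deriv_comp_const_add (fun u => ((c u : ℍ) : ℂ)) s 0, add_zero]

/-- The holonomy of the two geodesics through an intersection point determines the angle: with
`κ = cos (θ / 2)` up to sign, the holonomy `γ * δ` of the loop product has trace
`2 cosh ((a - b) / 2) + 2 κ² (cosh ((a + b) / 2) - cosh ((a - b) / 2))`, where `a` and `b` are the
lengths of the geodesics. -/
theorem IntersectionPoint.exists_holonomy {x y : X.ClosedGeodesic} (p : IntersectionPoint x y) :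
    ∃ (γ δ : X.Γ) (M : SL(2, ℝ)) (κ : ℝ), IsPairHolonomy X.proj p.loopFst p.loopSnd γ δ ∧
      ((γ * δ : X.Γ) : PSL(2, ℝ)) = QuotientGroup.mk M ∧
      (M : Matrix (Fin 2) (Fin 2) ℝ).trace = 2 * Real.cosh ((x.length - y.length) / 2) +
        2 * κ ^ 2 * (Real.cosh ((x.length + y.length) / 2) -
          Real.cosh ((x.length - y.length) / 2)) ∧
      p.angle = Real.arccos (2 * κ ^ 2 - 1) := by
  rw [IntersectionPoint.angle]
  obtain ⟨hc, hd, hcd⟩ := p.exists_lifts.choose_spec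
  set c := p.exists_lifts.choose.1
  set d := p.exists_lifts.choose.2
  obtain ⟨γ, hγ⟩ := x.exists_deck hc
  obtain ⟨δ, hδ⟩ := y.exists_deck hd
  obtain ⟨g, hg⟩ := exists_smul_axisPoint_of_isometry (isometry_subtype_coe.comp hc.isometry) p.s
  obtain ⟨h, hh⟩ := exists_smul_axisPoint_of_isometry (isometry_subtype_coe.comp hd.isometry) p.t
  have hk : (g⁻¹ * h) • UpperHalfPlane.I = UpperHalfPlane.I := by
    rw [mul_smul, inv_smul_eq_iff, ← axisPoint_zero, ← hg 0, ← hh 0]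
    simp [hcd]
  have hγ' := eq_mk_axisTranslation (γ := γ) (g := g) (ℓ := x.length) fun u => by
    rw [← hg, ← hg, ← add_assoc]; exact (congr_arg Subtype.val (hγ (p.s + u))).symm
  have hδ' := eq_mk_axisTranslation (γ := δ) (g := h) (ℓ := y.length) fun u => by
    rw [← hh, ← hh, ← add_assoc]; exact (congr_arg Subtype.val (hδ (p.t + u))).symm
  refine ⟨γ, δ,
    g * axisTranslation x.length * g⁻¹ * (h * axisTranslation y.length * h⁻¹), (g⁻¹ * h : SL(2, ℝ)) 0 0, p.isPairHolonomy hc hd hcd hγ hδ, ?_, ?_, ?_⟩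
  · rw [Subgroup.coe_mul, hγ', hδ']; rfl
  · rw [← trace_axisTranslation_mul hk, show g * axisTranslation x.length * g⁻¹ *
      (h * axisTranslation y.length * h⁻¹) = g * (axisTranslation x.length *
        (g⁻¹ * h * axisTranslation y.length * (g⁻¹ * h)⁻¹)) * g⁻¹ by group,
      Matrix.SpecialLinearGroup.coe_mul, Matrix.trace_mul_comm,
      ← Matrix.SpecialLinearGroup.coe_mul, inv_mul_cancel_left]
  · rw [direction_eq hg, direction_eq hh, ← angle_axis hk g, mul_inv_cancel_left]

end HyperbolicSurface

theorem theorem5p1 {F : Type*} [TopologicalSpace F] (X : MarkedHyperbolicSurface F)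
    (x y : X.toHyperbolicSurface.ClosedGeodesic)
    (p q : HyperbolicSurface.IntersectionPoint x y)
    (hpq : FreelyHomotopic p.loopProduct q.loopProduct)
    (Y : MarkedHyperbolicSurface F)
    (x' y' : Y.toHyperbolicSurface.ClosedGeodesic)
    (hx : x.IsRepresentative (X.change Y) x') (hy : y.IsRepresentative (X.change Y) y')
    (p' q' : HyperbolicSurface.IntersectionPoint x' y')
    (hp : p.CorrespondsTo (X.change Y) p') (hq : q.CorrespondsTo (X.change Y) q') :
    p'.angle = q'.angle := by
  have hf := Y.isQuotientCoveringMap_proj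
  obtain ⟨γ, δ, M, κ, hol, hM, htr, hθ⟩ := p'.exists_holonomy
  obtain ⟨γ', δ', N, κ', hol', hN, htr', hθ'⟩ := q'.exists_holonomy
  have hconj : IsConj (γ * δ) (γ' * δ') := by
    have h := ((hol.of_simultaneouslyFreelyHomotopic hf hp.symm).trans hf)
    have h' := ((hol'.of_simultaneouslyFreelyHomotopic hf hq.symm).trans hf)
    rw [← Path.map_trans] at h h'
    exact (h.of_freelyHomotopic hf (hpq.map (X.change Y).continuous)).isConj hf h'
  have hconj' := Y.Γ.subtype.map_isConj hconj
  rw [Subgroup.subtype_apply, Subgroup.subtype_apply, hM, hN] at hconj'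
  have hsq := trace_sq_eq_of_isConj_mk hconj'
  have hlt : Real.cosh ((x'.length - y'.length) / 2) < Real.cosh ((x'.length + y'.length) / 2) := by
    have := x'.length_pos
    have := y'.length_pos
    rw [Real.cosh_lt_cosh, abs_of_pos (show 0 < (x'.length + y'.length) / 2 by linarith), abs_lt]
    constructor <;> linarith
  have hpos := Real.cosh_pos ((x'.length - y'.length) / 2)
  -- both traces are positive, so that no sign is lost in the passage to `PSL(2, ℝ)`
  rw [htr, htr', sq_eq_sq₀ (by have := sub_pos.2 hlt; positivity)
    (by have := sub_pos.2 hlt; positivity)] at hsq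
  have hκ : κ ^ 2 = κ' ^ 2 := by
    refine mul_right_cancel₀ (sub_pos.2 hlt).ne' ?_
    linarith
  rw [hθ, hθ', hκ]
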